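/- Let $n \ge 1$, let $\Omega \subset \mathbb{R}^n$ be a bounded domain (non-empty, open and connected), and fix $0 < \alpha \le 1$. For real $p$ let $$\lambda_p = \inf_{\phi} \frac{\displaystyle\int_{\mathbb{R}^n}\int_{\mathbb{R}^n} \frac{|\phi(y)-\phi(x)|^p}{|y-x|^{\alpha p}}\,dx\,dy}{\displaystyle\int_{\mathbb{R}^n} |\phi(x)|^p\,dx} \in [0,\infty]$$ be the first eigenvalue, and let $$\Lambda_\infty^\alpha = \inf_{\phi} \frac{\displaystyle\left\| \frac{\phi(y)-\phi(x)}{|y-x|^{\alpha}} \right\|_{L^\infty(\mathbb{R}^n\times\mathbb{R}^n)}}{\displaystyle\|\phi\|_{L^\infty(\mathbb{R}^n)}}$$ be the $\infty$-eigenvalue. Both infima are taken over all real functions $\phi \in C_0^\infty(\Omega)$ (smooth with compact support in $\Omega$, extended by zero), $\phi \not\equiv 0$. Put $R = \sup_{x\in\Omega} \operatorname{dist}(x, \mathbb{R}^n\setminus\Omega)$. Then $R > 0$, this supremum is attained, $R$ is the radius of the largest open ball contained in $\Omega$, and $$\lim_{p\to\infty} \lambda_p^{1/p} = \frac{1}{R^{\alpha}},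 \qquad \Lambda_\infty^\alpha = R^{-\alpha}.$$ -/

import Mathlib

open Set Filter Topology MeasureTheory
open scoped ENNReal ContDiff

noncomputable section

/-- `φ` is an admissible competitor for `Ω`: a smooth real function with compact support
contained in `Ω` (extended by zero to the whole space), not identically zero. -/
structure IsAdmissible {n : ℕ} (Ω : Set (EuclideanSpace ℝ (Fin n)))
    (φ : EuclideanSpace ℝ (Fin n) → ℝ) : Prop where
  smooth : ContDiff ℝ ∞ φ
  compactSupport : HasCompactSupport φ
  support_subset : tsupport φ ⊆ Ω
  ne_zero : φ ≠ 0

/-- The fractional Rayleigh quotient, as an extended nonnegative number. The integrand is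
nonnegative and the diagonal `x = y` is a null set in positive dimension. -/
def rayleighQuotient {n : ℕ} (α p : ℝ) (φ : EuclideanSpace ℝ (Fin n) → ℝ) : ℝ≥0∞ :=
  (∫⁻ y, ∫⁻ x, ENNReal.ofReal (|φ y - φ x| ^ p / ‖y - x‖ ^ (α * p))) /
    ∫⁻ x, ENNReal.ofReal (|φ x| ^ p)

/-- The first eigenvalue `λ_p` of `Ω`: the infimum of the fractional Rayleigh quotient. -/
def firstEigenvalue {n : ℕ} (α p : ℝ) (Ω : Set (EuclideanSpace ℝ (Fin n))) : ℝ≥0∞ :=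
  ⨅ (φ : EuclideanSpace ℝ (Fin n) → ℝ) (_ : IsAdmissible Ω φ), rayleighQuotient α p φ

/-- The quotient of the `L^∞` norm of `(φ y - φ x) / |y - x| ^ α` on `ℝⁿ × ℝⁿ` and the
`L^∞` norm of `φ` on `ℝⁿ`. -/
def inftyQuotient {n : ℕ} (α : ℝ) (φ : EuclideanSpace ℝ (Fin n) → ℝ) : ℝ≥0∞ :=
  eLpNorm (fun z : EuclideanSpace ℝ (Fin n) × EuclideanSpace ℝ (Fin n) =>
      (φ z.2 - φ z.1) / ‖z.2 - z.1‖ ^ α) ∞ (volume.prod volume) /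
    eLpNorm φ ∞ volume

/-- The `∞`-eigenvalue of `Ω`: the infimum of the limiting quotient. -/
def inftyEigenvalue {n : ℕ} (α : ℝ) (Ω : Set (EuclideanSpace ℝ (Fin n))) : ℝ≥0∞ :=
  ⨅ (φ : EuclideanSpace ℝ (Fin n) → ℝ) (_ : IsAdmissible Ω φ), inftyQuotient α φ

/-- The supremum over `x ∈ Ω` of the distance from `x` to the complement of `Ω`. -/
def inradius {n : ℕ} (Ω : Set (EuclideanSpace ℝ (Fin n))) : ℝ :=
  sSup ((fun x => Metric.infDist x Ωᶜ) '' Ω)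

end

/-! ### The inradius -/

section Inradius

variable {n : ℕ} {Ω : Set (EuclideanSpace ℝ (Fin n))}

/-! Both limits rest on the same two facts.

Lower bounds: an admissible `φ` attains `max |φ| = M` at some `x ∈ Ω`, and some `y ∉ Ω`, where `φ`
vanishes, lies within `R` of `x`. For the `∞`-quotient the Hölder bound between `x` and `y` gives `M
≤ S * R ^ α` directly. For finite `p` it is replaced by a Morrey estimate (`abs_sub_le_mul_toReal`):
`M` is at most a constant times the `p`-th root of the energy, while the denominator is at most `M ^
p` times the volume of `Ω`. The constant must be sharp in the limit: averages over balls of radius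
`r` around `x` and `y` are compared with a factor tending to `(R + 2r) ^ α`, and passing from
averages to point values costs `O(r ^ α)` uniformly in `p`. Letting `p → ∞` and then `r → 0` leaves
`R ^ α`.

Upper bounds: a smoothed cone over an inscribed ball (`exists_isAdmissible_lipschitz`) is
`1`-Lipschitz with height `h` close to `R`. Interpolating slope against height gives the `α`-Hölder
constant `h ^ (1 - α)`, so the `∞`-quotient is at most `h ^ (-α)`. For finite `p`, the energy is at
most the `(p - q)`-th power of the Hölder constant times a finite energy at a fixed exponent `q`,
whose contribution disappears under the `p`-th root. -/

lemma compl_nonempty_of_isBounded (hn : 1 ≤ n) (hb : Bornology.IsBounded Ω) : Ωᶜ.Nonempty := by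
  have : Nonempty (Fin n) := ⟨⟨0, hn⟩⟩
  rw [nonempty_compl]
  rintro rfl
  exact NormedSpace.unbounded_univ ℝ (EuclideanSpace ℝ (Fin n)) hb

/-- The distance to the complement is continuous, so it has a maximiser on the compact closure; its
value there is positive, which forces the maximiser into `Ω`. -/
lemma exists_isGreatest_infDist_compl (hn : 1 ≤ n) (ho : IsOpen Ω) (hne : Ω.Nonempty)
    (hb : Bornology.IsBounded Ω) :
    0 < inradius Ω ∧ IsGreatest ((fun x => Metric.infDist x Ωᶜ) '' Ω) (inradius Ω) := by
  have hc := compl_nonempty_of_isBounded hn hb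
  have hpos : ∀ x ∈ Ω, 0 < Metric.infDist x Ωᶜ := fun x hx =>
    (ho.isClosed_compl.notMem_iff_infDist_pos hc).1 (by simpa using hx)
  obtain ⟨x₀, -, hmax⟩ := hb.isCompact_closure.exists_isMaxOn hne.closure
    (Metric.continuous_infDist_pt Ωᶜ).continuousOn
  have hmax' : ∀ x ∈ Ω, Metric.infDist x Ωᶜ ≤ Metric.infDist x₀ Ωᶜ := fun x hx =>
    hmax (subset_closure hx)
  obtain ⟨w, hw⟩ := hne
  have h0 : 0 < Metric.infDist x₀ Ωᶜ := (hpos w hw).trans_le (hmax' w hw)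
  have hx₀ : x₀ ∈ Ω := by
    by_contra h
    exact h0.ne' (Metric.infDist_zero_of_mem h)
  have hg : IsGreatest ((fun x => Metric.infDist x Ωᶜ) '' Ω) (Metric.infDist x₀ Ωᶜ) :=
    ⟨⟨x₀, hx₀, rfl⟩, by rintro _ ⟨x, hx, rfl⟩; exact hmax' x hx⟩
  have he : inradius Ω = Metric.infDist x₀ Ωᶜ := hg.csSup_eq
  rw [he]
  exact ⟨h0, hg⟩

lemma ball_infDist_compl_subset (x : EuclideanSpace ℝ (Fin n)) :
    Metric.ball x (Metric.infDist x Ωᶜ) ⊆ Ω := by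
  intro y hy
  by_contra h
  have := Metric.infDist_le_dist_of_mem (x := x) (s := Ωᶜ) h
  rw [Metric.mem_ball, dist_comm] at hy
  linarith

lemma isGreatest_radius_inscribed_ball (hn : 1 ≤ n) (ho : IsOpen Ω) (hne : Ω.Nonempty)
    (hb : Bornology.IsBounded Ω) :
    IsGreatest {r : ℝ | ∃ x, Metric.ball x r ⊆ Ω} (inradius Ω) := by
  obtain ⟨h0, ⟨x₀, hx₀, he⟩, hub⟩ := exists_isGreatest_infDist_compl hn ho hne hb
  refine ⟨⟨x₀, he ▸ ball_infDist_compl_subset x₀⟩, ?_⟩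
  rintro r ⟨x, hx⟩
  rcases le_or_gt r 0 with hr | hr
  · linarith
  · refine le_trans ?_ (hub ⟨x, hx (Metric.mem_ball_self hr), rfl⟩)
    refine (Metric.le_infDist (compl_nonempty_of_isBounded hn hb)).2 fun y hy => ?_
    by_contra! h
    exact hy (hx (by rwa [Metric.mem_ball, dist_comm]))

/-- This supplies the zero of `φ` that both lower bounds compare with a maximum point of `|φ|`. -/
lemma exists_notMem_dist_le_inradius (hn : 1 ≤ n) (ho : IsOpen Ω) (hb : Bornology.IsBounded Ω)
    {x : EuclideanSpace ℝ (Fin n)} (hx : x ∈ Ω) : ∃ y ∉ Ω, dist x y ≤ inradius Ω := by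
  obtain ⟨y, hy, he⟩ := ho.isClosed_compl.exists_infDist_eq_dist
    (compl_nonempty_of_isBounded hn hb) x
  exact ⟨y, hy, he ▸ (exists_isGreatest_infDist_compl hn ho ⟨x, hx⟩ hb).2.2 ⟨x, hx, rfl⟩⟩

end Inradius

/-! ### Admissible functions close to a cone -/

/-- A smooth monotone `1`-Lipschitz function vanishing on `(-∞, 0]` and equal to the identity up to
an additive constant at most `δ` on `[δ, ∞)`. -/
noncomputable def smoothRamp (δ t : ℝ) : ℝ := ∫ s in (0 : ℝ)..t, Real.smoothTransition (s / δ)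

section SmoothRamp

lemma contDiff_smoothTransition_div (δ : ℝ) :
    ContDiff ℝ ∞ fun s : ℝ => Real.smoothTransition (s / δ) :=
  Real.smoothTransition.contDiff.comp (contDiff_id.div_const δ)

lemma continuous_smoothTransition_div (δ : ℝ) :
    Continuous fun s : ℝ => Real.smoothTransition (s / δ) :=
  (contDiff_smoothTransition_div δ).continuous

lemma hasDerivAt_smoothRamp (δ t : ℝ) :
    HasDerivAt (smoothRamp δ) (Real.smoothTransition (t / δ)) t :=
  (continuous_smoothTransition_div δ).integral_hasStrictDerivAt 0 t |>.hasDerivAt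

lemma contDiff_smoothRamp (δ : ℝ) : ContDiff ℝ ∞ (smoothRamp δ) := by
  rw [contDiff_infty_iff_deriv]
  refine ⟨fun t => (hasDerivAt_smoothRamp δ t).differentiableAt, ?_⟩
  rw [funext fun t => (hasDerivAt_smoothRamp δ t).deriv]
  exact contDiff_smoothTransition_div δ

lemma lipschitzWith_smoothRamp (δ : ℝ) : LipschitzWith 1 (smoothRamp δ) := by
  refine lipschitzWith_of_nnnorm_deriv_le
    (fun t => (hasDerivAt_smoothRamp δ t).differentiableAt) fun t => ?_
  rw [(hasDerivAt_smoothRamp δ t).deriv, ← NNReal.coe_le_coe, coe_nnnorm, Real.norm_eq_abs,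
    abs_of_nonneg (Real.smoothTransition.nonneg _)]
  exact Real.smoothTransition.le_one _

lemma monotone_smoothRamp (δ : ℝ) : Monotone (smoothRamp δ) := by
  refine monotone_of_deriv_nonneg (fun t => (hasDerivAt_smoothRamp δ t).differentiableAt)
    fun t => ?_
  rw [(hasDerivAt_smoothRamp δ t).deriv]
  exact Real.smoothTransition.nonneg _

lemma smoothRamp_of_nonpos {δ t : ℝ} (hδ : 0 < δ) (ht : t ≤ 0) : smoothRamp δ t = 0 := by
  have : ∫ s in (0 : ℝ)..t, Real.smoothTransition (s / δ) = ∫ s in (0 : ℝ)..t, (0 : ℝ) := by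
    refine intervalIntegral.integral_congr fun s hs => ?_
    rw [uIcc_of_ge ht] at hs
    exact Real.smoothTransition.zero_of_nonpos (div_nonpos_of_nonpos_of_nonneg hs.2 hδ.le)
  simpa [smoothRamp] using this

lemma smoothRamp_nonneg {δ : ℝ} (hδ : 0 < δ) (t : ℝ) : 0 ≤ smoothRamp δ t := by
  rcases le_total t 0 with ht | ht
  · exact (smoothRamp_of_nonpos hδ ht).ge
  · exact (smoothRamp_of_nonpos hδ le_rfl).ge.trans (monotone_smoothRamp δ ht)

lemma sub_le_smoothRamp {δ t : ℝ} (hδ : 0 < δ) (ht : δ ≤ t) : t - δ ≤ smoothRamp δ t := by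
  have h1 : ∫ s in δ..t, Real.smoothTransition (s / δ) = ∫ s in δ..t, (1 : ℝ) := by
    refine intervalIntegral.integral_congr fun s hs => ?_
    rw [uIcc_of_le ht] at hs
    exact Real.smoothTransition.one_of_one_le ((one_le_div hδ).2 hs.1)
  have h2 := intervalIntegral.integral_add_adjacent_intervals (a := 0) (b := δ) (c := t)
    ((continuous_smoothTransition_div δ).intervalIntegrable (μ := volume) _ _)
    ((continuous_smoothTransition_div δ).intervalIntegrable _ _)
  have h3 := smoothRamp_nonneg hδ δ
  simp only [smoothRamp] at h3 ⊢
  rw [← h2, h1]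
  simpa using h3

end SmoothRamp

/-- This is the reverse triangle inequality for the plane vectors `(ε, a)` and `(ε, b)`; it keeps
the smoothed norm `1`-Lipschitz. -/
lemma abs_sqrt_sq_add_sq_sub_le (ε a b : ℝ) : |√(ε ^ 2 + a ^ 2) - √(ε ^ 2 + b ^ 2)| ≤ |a - b| := by
  have key : ∀ a b : ℝ, √(ε ^ 2 + a ^ 2) ≤ √(ε ^ 2 + b ^ 2) + |a - b| := fun a b => by
    have hs := Real.sq_sqrt (show 0 ≤ ε ^ 2 + b ^ 2 by positivity)
    have hb : |b| ≤ √(ε ^ 2 + b ^ 2) := Real.abs_le_sqrt (by nlinarith [sq_nonneg ε])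
    have h1 : b * (a - b) ≤ √(ε ^ 2 + b ^ 2) * |a - b| :=
      (le_abs_self _).trans (by rw [abs_mul]; gcongr)
    refine Real.sqrt_le_iff.2 ⟨by positivity, ?_⟩
    nlinarith [sq_abs (a - b)]
  rw [abs_sub_le_iff]
  exact ⟨by linarith [key a b], by linarith [key b a, abs_sub_comm a b]⟩

/-- The cone `r - ‖x - x₀‖` is singular at its tip and at its base. Replacing the norm by `√(ε ^ 2 +
‖x - x₀‖ ^ 2)` smooths the tip, and `smoothRamp` smooths the truncation at zero; neither increases
the slope. -/
lemma exists_isAdmissible_lipschitz {n : ℕ} {Ω : Set (EuclideanSpace ℝ (Fin n))}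
    {x₀ : EuclideanSpace ℝ (Fin n)} {m R : ℝ} (hm : 0 < m) (hmR : m < R)
    (hball : Metric.ball x₀ R ⊆ Ω) :
    ∃ φ : EuclideanSpace ℝ (Fin n) → ℝ, IsAdmissible Ω φ ∧ (∀ x y, |φ y - φ x| ≤ ‖y - x‖) ∧
      (∀ x, 0 ≤ φ x) ∧ (∀ x, φ x ≤ φ x₀) ∧ m ≤ φ x₀ := by
  -- Rounding the tip and the ramp each cost `ε` in height, and `r - 2 * ε = m` exactly; `r < R`
  -- keeps the closed support inside the open ball.
  obtain ⟨r, hr⟩ : ∃ r, r = (R + m) / 2 := ⟨_, rfl⟩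
  obtain ⟨ε, hε⟩ : ∃ ε, ε = (R - m) / 4 := ⟨_, rfl⟩
  have hε0 : 0 < ε := by linarith
  let g : EuclideanSpace ℝ (Fin n) → ℝ := fun x => √(ε ^ 2 + ‖x - x₀‖ ^ 2)
  have hgx₀ : g x₀ = ε := by simp [g, hε0.le]
  have hgε : ∀ x, ε ≤ g x := fun x => Real.le_sqrt_of_sq_le (by nlinarith [sq_nonneg ‖x - x₀‖])
  have hgn : ∀ x, ‖x - x₀‖ ≤ g x := fun x => Real.le_sqrt_of_sq_le (by nlinarith [sq_nonneg ε])
  have hgs : ContDiff ℝ ∞ g := by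
    refine ContDiff.sqrt ?_ fun x => by positivity
    exact contDiff_const.add ((contDiff_id.sub contDiff_const).norm_sq ℝ)
  have hsupp : ∀ x ∉ Metric.closedBall x₀ r, smoothRamp ε (r - g x) = 0 := fun x hx => by
    refine smoothRamp_of_nonpos hε0 ?_
    rw [Metric.mem_closedBall, dist_eq_norm, not_le] at hx
    linarith [hgn x]
  have hm' : m ≤ smoothRamp ε (r - g x₀) := by
    rw [hgx₀]
    exact le_trans (by linarith) (sub_le_smoothRamp hε0 (by linarith))
  have hts : tsupport (fun x => smoothRamp ε (r - g x)) ⊆ Metric.closedBall x₀ r :=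
    closure_minimal (fun x hx => by_contra fun h => hx (hsupp x h)) Metric.isClosed_closedBall
  refine ⟨fun x => smoothRamp ε (r - g x), ⟨?_, ?_, ?_, ?_⟩, fun x y => ?_, fun x => ?_,
    fun x => ?_, hm'⟩
  · exact (contDiff_smoothRamp ε).comp (contDiff_const.sub hgs)
  · exact HasCompactSupport.intro (isCompact_closedBall x₀ r) hsupp
  · exact hts.trans ((Metric.closedBall_subset_ball (by linarith)).trans hball)
  · intro h
    have := congrFun h x₀
    simp only [Pi.zero_apply] at this
    linarith
  · have h1 := (lipschitzWith_smoothRamp ε).dist_le_mul (r - g y) (r - g x)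
    rw [Real.dist_eq, Real.dist_eq, NNReal.coe_one, one_mul] at h1
    refine h1.trans ?_
    rw [show r - g y - (r - g x) = g x - g y by ring]
    refine (abs_sqrt_sq_add_sq_sub_le ε _ _).trans ((abs_norm_sub_norm_le _ _).trans ?_)
    rw [sub_sub_sub_cancel_right, norm_sub_rev]
  · exact smoothRamp_nonneg hε0 _
  · exact monotone_smoothRamp ε (by linarith [hgε x])

/-! ### A Morrey estimate with constants uniform in the exponent -/

section Morrey

variable {n : ℕ} {φ : EuclideanSpace ℝ (Fin n) → ℝ} {α p : ℝ}

/-- The `p`-th power of the fractional Gagliardo seminorm. -/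
noncomputable def gagliardoEnergy (α p : ℝ) (φ : EuclideanSpace ℝ (Fin n) → ℝ) : ℝ≥0∞ :=
  ∫⁻ y, ∫⁻ x, ENNReal.ofReal (|φ y - φ x| ^ p / ‖y - x‖ ^ (α * p))

lemma gagliardoEnergy_eq_lintegral_prod (hφ : Continuous φ) :
    gagliardoEnergy α p φ = ∫⁻ z : EuclideanSpace ℝ (Fin n) × EuclideanSpace ℝ (Fin n),
      ENNReal.ofReal (|φ z.1 - φ z.2| ^ p / ‖z.1 - z.2‖ ^ (α * p)) ∂(volume.prod volume) := by
  have hm : Measurable φ := hφ.measurable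
  rw [lintegral_prod _ (by fun_prop)]
  rfl

lemma rpow_abs_sub_le_mul_div (hα : 0 < α) (hp : 1 ≤ p) {D : ℝ}
    {x y : EuclideanSpace ℝ (Fin n)} (hD : ‖y - x‖ ≤ D) :
    |φ y - φ x| ^ p ≤ (D ^ α) ^ p * (|φ y - φ x| ^ p / ‖y - x‖ ^ (α * p)) := by
  have hp0 : 0 < p := by linarith
  rcases eq_or_ne y x with rfl | hne
  · simp [hp0.ne']
  · have h0 : 0 < ‖y - x‖ := norm_pos_iff.2 (sub_ne_zero.2 hne)
    have hD0 := h0.trans_le hD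
    rw [← Real.rpow_mul hD0.le, mul_div_assoc', le_div_iff₀ (by positivity), mul_comm]
    gcongr

/-- Hölder's inequality on `A ×ˢ B` passes from exponent `1` to `p`; the singular weight is then
inserted at the price of `D ^ α`, since all distances are at most `D`. -/
lemma setLIntegral_enorm_sub_le (hφ : Continuous φ) (hα : 0 < α) (hp : 1 ≤ p)
    {A B : Set (EuclideanSpace ℝ (Fin n))} (hA : MeasurableSet A) (hB : MeasurableSet B) {D : ℝ}
    (hD0 : 0 ≤ D) (hD : ∀ y ∈ A, ∀ x ∈ B, ‖y - x‖ ≤ D) :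
    ∫⁻ z in A ×ˢ B, ‖φ z.1 - φ z.2‖ₑ ∂(volume.prod volume) ≤
      ENNReal.ofReal (D ^ α) * gagliardoEnergy α p φ ^ (1 / p) *
        (volume A * volume B) ^ (1 - 1 / p) := by
  have hp0 : 0 < p := by linarith
  have h1 := eLpNorm'_le_eLpNorm'_mul_rpow_measure_univ (p := 1) (q := p) (one_pos) hp
    (f := fun z : EuclideanSpace ℝ (Fin n) × EuclideanSpace ℝ (Fin n) => φ z.1 - φ z.2)
    (μ := ((volume.prod volume).restrict (A ×ˢ B)))
    (by fun_prop : Continuous _).aestronglyMeasurable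
  simp only [eLpNorm', ENNReal.rpow_one, div_one, Measure.restrict_apply_univ,
    Measure.prod_prod] at h1
  refine h1.trans ?_
  gcongr
  have h2 : ∫⁻ z in A ×ˢ B, ‖φ z.1 - φ z.2‖ₑ ^ p ∂(volume.prod volume) ≤
      ENNReal.ofReal ((D ^ α) ^ p) * gagliardoEnergy α p φ := by
    rw [gagliardoEnergy_eq_lintegral_prod hφ, ← lintegral_const_mul' _ _ ENNReal.ofReal_ne_top]
    refine (setLIntegral_mono' (hA.prod hB) fun z hz => ?_).trans
      (setLIntegral_le_lintegral _ _)
    rw [Real.enorm_eq_ofReal_abs, ENNReal.ofReal_rpow_of_nonneg (abs_nonneg _) hp0.le,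
      ← ENNReal.ofReal_mul (by positivity)]
    exact ENNReal.ofReal_le_ofReal (rpow_abs_sub_le_mul_div hα hp (hD _ hz.1 _ hz.2))
  refine (ENNReal.rpow_le_rpow h2 (by positivity)).trans_eq ?_
  rw [ENNReal.mul_rpow_of_nonneg _ _ (by positivity),
    ENNReal.ofReal_rpow_of_nonneg (by positivity) (by positivity), one_div,
    Real.rpow_rpow_inv (by positivity) hp0.ne']

lemma setAverage_sub_setAverage (hφ : Continuous φ) {A B : Set (EuclideanSpace ℝ (Fin n))}
    (hA : Bornology.IsBounded A) (hB : Bornology.IsBounded B)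
    (hA0 : volume.real A ≠ 0) (hB0 : volume.real B ≠ 0) :
    (volume.real A * volume.real B) * ((⨍ y in A, φ y) - ⨍ x in B, φ x) =
      ∫ z in A ×ˢ B, (φ z.1 - φ z.2) ∂(volume.prod volume) := by
  have hint : ∀ S : Set (EuclideanSpace ℝ (Fin n)), Bornology.IsBounded S →
      IntegrableOn φ S := fun S hS =>
    (hφ.continuousOn.integrableOn_compact hS.isCompact_closure).mono_set subset_closure
  have : IsFiniteMeasure (volume.restrict A) := ⟨by simpa using hA.measure_lt_top⟩
  have : IsFiniteMeasure (volume.restrict B) := ⟨by simpa using hB.measure_lt_top⟩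
  rw [← Measure.prod_restrict, integral_sub ((hint A hA).comp_fst _) ((hint B hB).comp_snd _),
    integral_fun_fst, integral_fun_snd, setAverage_eq, setAverage_eq]
  simp only [measureReal_restrict_apply_univ, smul_eq_mul]
  field_simp

/-- Dividing the double integral by the product of the volumes leaves only the power `-(1 / p)` of
that product, which tends to `1`. Hence `D ^ α` is the whole constant in the limit. -/
lemma abs_setAverage_ball_sub_le (hφ : Continuous φ) (hα : 0 < α) (hp : 1 ≤ p)
    (hJ : gagliardoEnergy α p φ ≠ ⊤) (u v : EuclideanSpace ℝ (Fin n)) {a b D : ℝ}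
    (ha : 0 < a) (hb : 0 < b) (hD : dist u v + a + b ≤ D) :
    |(⨍ y in Metric.ball u a, φ y) - ⨍ x in Metric.ball v b, φ x| ≤
      D ^ α * (gagliardoEnergy α p φ ^ (1 / p)).toReal *
        (volume.real (Metric.ball u a) * volume.real (Metric.ball v b)) ^ (-(1 / p)) := by
  have hp0 : 0 < p := by linarith
  have hD0 : 0 ≤ D := by linarith [dist_nonneg (x := u) (y := v)]
  have hvol : ∀ (w : EuclideanSpace ℝ (Fin n)) {r : ℝ}, 0 < r →
      0 < volume.real (Metric.ball w r) := fun w r hr =>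
    ENNReal.toReal_pos (Metric.measure_ball_pos _ _ hr).ne' measure_ball_lt_top.ne
  have hA := hvol u ha
  have hB := hvol v hb
  have h1 := setAverage_sub_setAverage hφ (Metric.isBounded_ball (x := u) (r := a))
    (Metric.isBounded_ball (x := v) (r := b)) hA.ne' hB.ne'
  have h2 := setLIntegral_enorm_sub_le (p := p) hφ hα hp
    (measurableSet_ball (x := u) (ε := a)) (measurableSet_ball (x := v) (ε := b)) hD0
    (fun y hy x hx => by
      rw [← dist_eq_norm]
      rw [Metric.mem_ball] at hy hx
      linarith [dist_triangle4 y u v x, dist_comm x v])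
  set J := gagliardoEnergy α p φ
  have hJp : J ^ (1 / p) ≠ ⊤ := ENNReal.rpow_ne_top_of_nonneg (by positivity) hJ
  have hV : (volume (Metric.ball u a) * volume (Metric.ball v b)) ^ (1 - 1 / p) ≠ ⊤ := by
    refine ENNReal.rpow_ne_top_of_nonneg ?_
      (ENNReal.mul_ne_top measure_ball_lt_top.ne measure_ball_lt_top.ne)
    rw [sub_nonneg]; exact (div_le_one hp0).2 hp
  have h3 : |∫ z in Metric.ball u a ×ˢ Metric.ball v b, (φ z.1 - φ z.2) ∂(volume.prod volume)| ≤
      D ^ α * (J ^ (1 / p)).toReal *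
        (volume.real (Metric.ball u a) * volume.real (Metric.ball v b)) ^ (1 - 1 / p) := by
    rw [← Real.norm_eq_abs]
    refine (norm_integral_le_lintegral_norm _).trans ?_
    simp only [ofReal_norm]
    refine (ENNReal.toReal_mono
      (ENNReal.mul_ne_top (ENNReal.mul_ne_top ENNReal.ofReal_ne_top hJp) hV) h2).trans_eq ?_
    rw [ENNReal.toReal_mul, ENNReal.toReal_mul, ENNReal.toReal_ofReal (by positivity),
      ← ENNReal.toReal_rpow _ (1 - 1 / p), ENNReal.toReal_mul]
    rfl
  have hAB := mul_pos hA hB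
  rw [← h1, abs_mul, abs_of_pos hAB, sub_eq_add_neg 1, Real.rpow_add hAB, Real.rpow_one] at h3
  refine le_of_mul_le_mul_left (h3.trans_eq ?_) hAB
  ring

lemma tendsto_setAverage_ball (hφ : Continuous φ) (x : EuclideanSpace ℝ (Fin n)) {r : ℕ → ℝ}
    (hr0 : ∀ k, 0 < r k) (hr : Tendsto r atTop (𝓝 0)) :
    Tendsto (fun k => ⨍ y in Metric.ball x (r k), φ y) atTop (𝓝 (φ x)) := by
  rw [Metric.tendsto_atTop']
  intro ε hε
  obtain ⟨δ, hδ, hδε⟩ := Metric.continuous_iff.1 hφ x (ε / 2) (by positivity)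
  obtain ⟨N, hN⟩ := eventually_atTop.1 (hr.eventually_lt_const hδ)
  refine ⟨N, fun k hk => ?_⟩
  have hmem : ⨍ y in Metric.ball x (r k), φ y ∈ Metric.closedBall (φ x) (ε / 2) := by
    refine (convex_closedBall (φ x) (ε / 2)).set_average_mem Metric.isClosed_closedBall
      (Metric.measure_ball_pos _ _ (hr0 k)).ne' measure_ball_lt_top.ne ?_ ?_
    · refine (ae_restrict_iff' measurableSet_ball).2 (Eventually.of_forall fun y hy => ?_)
      exact (hδε y ((Metric.mem_ball.1 hy).trans (hN k hk.le))).le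
    · exact (hφ.continuousOn.integrableOn_compact (isCompact_closedBall x (r k))).mono_set
        Metric.ball_subset_closedBall
  exact (Metric.mem_closedBall.1 hmem).trans_lt (by linarith)

/-- The volume of the Euclidean unit ball. -/
noncomputable def unitBallVolume (n : ℕ) : ℝ :=
  volume.real (Metric.ball (0 : EuclideanSpace ℝ (Fin n)) 1)

lemma unitBallVolume_pos (n : ℕ) : 0 < unitBallVolume n :=
  ENNReal.toReal_pos (Metric.measure_ball_pos _ _ one_pos).ne' measure_ball_lt_top.ne

lemma volume_real_ball_eq (x : EuclideanSpace ℝ (Fin n)) {r : ℝ} (hr : 0 < r) :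
    volume.real (Metric.ball x r) = r ^ n * unitBallVolume n := by
  simp [Measure.real, Measure.addHaar_ball_of_pos volume x hr, unitBallVolume,
    ENNReal.toReal_mul, hr.le]

/-- The averages over balls of radius `r / 2 ^ k` telescope to the point value. The condition `4 * n
≤ α * p` bounds the increments by a geometric series whose ratio `2 ^ (-(α / 2))` does not depend on
`p`. -/
lemma abs_setAverage_ball_sub_apply_le (hφ : Continuous φ) (hα : 0 < α) (hp : 1 ≤ p)
    (hpn : 4 * n ≤ α * p) (hJ : gagliardoEnergy α p φ ≠ ⊤) (x : EuclideanSpace ℝ (Fin n)) {r : ℝ}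
    (hr : 0 < r) :
    |(⨍ y in Metric.ball x r, φ y) - φ x| ≤
      (2 * r) ^ α * (gagliardoEnergy α p φ ^ (1 / p)).toReal *
        (r ^ n * unitBallVolume n * ((r / 2) ^ n * unitBallVolume n)) ^ (-(1 / p)) /
          (1 - 2 ^ (-(α / 2))) := by
  have hp0 : 0 < p := by linarith
  have hc := unitBallVolume_pos n
  set c := unitBallVolume n
  set E := (gagliardoEnergy α p φ ^ (1 / p)).toReal
  have hE : 0 ≤ E := ENNReal.toReal_nonneg
  have hs : ∀ k : ℕ, 0 < r / 2 ^ k := fun k => by positivity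
  have hlim : Tendsto (fun k : ℕ => r / 2 ^ k) atTop (𝓝 0) := by
    have := (tendsto_pow_atTop_nhds_zero_of_lt_one (r := (1 / 2 : ℝ)) (by norm_num)
      (by norm_num)).const_mul r
    simpa [div_eq_mul_inv] using this
  have hθ : (2 : ℝ) ^ (-(α / 2)) < 1 :=
    Real.rpow_lt_one_of_one_lt_of_neg (by norm_num) (by linarith)
  have key := dist_le_of_le_geometric_of_tendsto₀ ((2 : ℝ) ^ (-(α / 2)))
    ((2 * r) ^ α * E * (r ^ n * c * ((r / 2) ^ n * c)) ^ (-(1 / p))) hθ (fun k => ?_)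
    (tendsto_setAverage_ball hφ x hs hlim)
  · simpa [Real.dist_eq] using key
  · rw [Real.dist_eq]
    have h1 : r / 2 ^ (k + 1) ≤ r / 2 ^ k := by
      gcongr
      · norm_num
      · omega
    refine (abs_setAverage_ball_sub_le (p := p) (D := 2 * r / 2 ^ k) hφ hα hp hJ x x (hs k)
      (hs (k + 1)) ?_).trans ?_
    · rw [dist_self, show 2 * r / 2 ^ k = r / 2 ^ k + r / 2 ^ k by ring]
      linarith
    · rw [volume_real_ball_eq _ (hs k), volume_real_ball_eq _ (hs (k + 1))]
      have e1 : (r / 2 ^ k) ^ n * c * ((r / 2 ^ (k + 1)) ^ n * c) =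
          (r ^ n * c * ((r / 2) ^ n * c)) * ((2 : ℝ) ^ k) ^ (-(2 * n : ℝ)) := by
        rw [Real.rpow_neg (by positivity), show (2 * n : ℝ) = ((2 * n : ℕ) : ℝ) by push_cast; rfl,
          Real.rpow_natCast, pow_succ, ← div_div, div_pow, div_pow, div_pow, div_pow, pow_mul']
        field_simp
      have hk1 : (1 : ℝ) ≤ 2 ^ k := one_le_pow₀ (by norm_num)
      have h2k : (0 : ℝ) < 2 ^ k := by positivity
      -- The distance factor gains `2 ^ (-α * k)`; the shrinking volumes lose `2 ^ (2 * n * k / p)`,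
      -- at most half of that gain in the exponent.
      have e2 : ((2 : ℝ) ^ k) ^ (-α) * (((2 : ℝ) ^ k) ^ (-(2 * n : ℝ))) ^ (-(1 / p)) ≤
          ((2 : ℝ) ^ (-(α / 2))) ^ k := by
        rw [← Real.rpow_mul h2k.le, ← Real.rpow_add h2k,
          ← Real.rpow_natCast ((2 : ℝ) ^ (-(α / 2))), ← Real.rpow_mul (by norm_num),
          mul_comm _ (k : ℝ), Real.rpow_mul (by norm_num), Real.rpow_natCast]
        refine Real.rpow_le_rpow_of_exponent_le hk1 ?_
        have : 2 * n * (1 / p) ≤ α / 2 := by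
          rw [mul_one_div, div_le_div_iff₀ hp0 two_pos]
          linarith
        linarith
      rw [e1, Real.mul_rpow (by positivity) (by positivity), Real.div_rpow (by positivity)
        h2k.le, div_eq_mul_inv, ← Real.rpow_neg h2k.le]
      calc _ = ((2 * r) ^ α * E * (r ^ n * c * ((r / 2) ^ n * c)) ^ (-(1 / p))) *
            (((2 : ℝ) ^ k) ^ (-α) * (((2 : ℝ) ^ k) ^ (-(2 * n : ℝ))) ^ (-(1 / p))) := by ring
        _ ≤ _ := by gcongr

/-- The chain runs from `φ x` to the average around `x`, to the average around `y`, to `φ y`. Only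
the middle link sees the distance `R`. -/
lemma abs_sub_le_mul_toReal (hφ : Continuous φ) (hα : 0 < α) (hp : 1 ≤ p)
    (hpn : 4 * n ≤ α * p) (hJ : gagliardoEnergy α p φ ≠ ⊤) {x y : EuclideanSpace ℝ (Fin n)}
    {r R : ℝ} (hr : 0 < r) (hR : dist x y ≤ R) :
    |φ x - φ y| ≤
      ((R + 2 * r) ^ α * (r ^ n * unitBallVolume n * (r ^ n * unitBallVolume n)) ^ (-(1 / p)) +
        2 * ((2 * r) ^ α *
        (r ^ n * unitBallVolume n * ((r / 2) ^ n * unitBallVolume n)) ^ (-(1 / p)) /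
          (1 - 2 ^ (-(α / 2))))) * (gagliardoEnergy α p φ ^ (1 / p)).toReal := by
  have h1 := abs_setAverage_ball_sub_apply_le hφ hα hp hpn hJ x hr
  have h2 := abs_setAverage_ball_sub_apply_le hφ hα hp hpn hJ y hr
  have h3 := abs_setAverage_ball_sub_le (p := p) (D := R + 2 * r) hφ hα hp hJ x y hr hr
    (by linarith)
  rw [volume_real_ball_eq _ hr, volume_real_ball_eq _ hr] at h3
  have h4 : |φ x - φ y| ≤ |(⨍ y in Metric.ball x r, φ y) - φ x| +
      |(⨍ z in Metric.ball x r, φ z) - ⨍ z in Metric.ball y r, φ z| +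
      |(⨍ z in Metric.ball y r, φ z) - φ y| := by
    rw [abs_sub_comm _ (φ x), show φ x - φ y = (φ x - ⨍ y in Metric.ball x r, φ y) +
      ((⨍ z in Metric.ball x r, φ z) - ⨍ z in Metric.ball y r, φ z) +
      ((⨍ z in Metric.ball y r, φ z) - φ y) by ring]
    exact abs_add_three _ _ _
  refine (h4.trans (add_le_add (add_le_add h1 h3) h2)).trans_eq ?_
  ring

end Morrey

/-! ### Lower bounds -/

section LowerBound

variable {n : ℕ} {Ω : Set (EuclideanSpace ℝ (Fin n))} {φ : EuclideanSpace ℝ (Fin n) → ℝ} {α p : ℝ}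

lemma rayleighQuotient_eq_gagliardoEnergy_div : rayleighQuotient α p φ =
    gagliardoEnergy α p φ / ∫⁻ x, ENNReal.ofReal (|φ x| ^ p) := rfl

lemma IsAdmissible.exists_abs_le (hφ : IsAdmissible Ω φ) :
    ∃ x ∈ Ω, 0 < |φ x| ∧ ∀ y, |φ y| ≤ |φ x| := by
  obtain ⟨w, hw⟩ : ∃ w, φ w ≠ 0 := Function.ne_iff.1 hφ.ne_zero
  have : Nonempty (EuclideanSpace ℝ (Fin n)) := ⟨w⟩
  obtain ⟨x, hx⟩ := hφ.smooth.continuous.abs.exists_forall_ge_of_hasCompactSupport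
    (hφ.compactSupport.comp_left (g := fun t : ℝ => |t|) abs_zero)
  have h0 : 0 < |φ x| := (abs_pos.2 hw).trans_le (hx w)
  exact ⟨x, hφ.support_subset (subset_tsupport _ (abs_pos.1 h0)), h0, hx⟩

lemma IsAdmissible.eq_zero_of_notMem (hφ : IsAdmissible Ω φ) {y : EuclideanSpace ℝ (Fin n)}
    (hy : y ∉ Ω) : φ y = 0 :=
  image_eq_zero_of_notMem_tsupport fun h => hy (hφ.support_subset h)

lemma lintegral_rpow_abs_le (hp : 0 < p) (ho : IsOpen Ω) (hsupp : ∀ y ∉ Ω, φ y = 0) {M : ℝ}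
    (hM : ∀ y, |φ y| ≤ M) :
    ∫⁻ x, ENNReal.ofReal (|φ x| ^ p) ≤ ENNReal.ofReal (M ^ p) * volume Ω := by
  rw [← lintegral_indicator_const ho.measurableSet]
  refine lintegral_mono fun x => ?_
  by_cases hx : x ∈ Ω
  · simp only [hx, indicator_of_mem]
    have := hM x
    gcongr
  · simp [hx, hsupp x hx, hp.ne']

/-- The constant in the Morrey estimate between two points at distance at most `R`, obtained from
averages over balls of radius `r`. -/
noncomputable def morreyConst (n : ℕ) (α R r p : ℝ) : ℝ :=
  (R + 2 * r) ^ α * (r ^ n * unitBallVolume n * (r ^ n * unitBallVolume n)) ^ (-(1 / p)) +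
    2 * ((2 * r) ^ α *
      (r ^ n * unitBallVolume n * ((r / 2) ^ n * unitBallVolume n)) ^ (-(1 / p)) /
        (1 - 2 ^ (-(α / 2))))

lemma one_sub_two_rpow_pos (hα : 0 < α) : (0 : ℝ) < 1 - 2 ^ (-(α / 2)) :=
  sub_pos.2 (Real.rpow_lt_one_of_one_lt_of_neg (by norm_num) (by linarith))

lemma morreyConst_pos {R r : ℝ} (hα : 0 < α) (hR : 0 < R) (hr : 0 < r) :
    0 < morreyConst n α R r p := by
  have := unitBallVolume_pos n
  have := one_sub_two_rpow_pos hα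
  unfold morreyConst
  positivity

/-- The maximum of `|φ|` enters numerator and denominator with the same power `p` and cancels, which
makes the bound uniform in `φ`. -/
lemma ofReal_le_firstEigenvalue (hn : 1 ≤ n) (ho : IsOpen Ω) (hb : Bornology.IsBounded Ω)
    (hne : Ω.Nonempty) (hα : 0 < α) (hp : 1 ≤ p) (hpn : 4 * n ≤ α * p) {r : ℝ} (hr : 0 < r) :
    ENNReal.ofReal ((volume.real Ω)⁻¹ * ((morreyConst n α (inradius Ω) r p)⁻¹) ^ p) ≤
      firstEigenvalue α p Ω := by
  have hp0 : 0 < p := by linarith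
  have hA := morreyConst_pos (n := n) (p := p) hα
    (exists_isGreatest_infDist_compl hn ho hne hb).1 hr
  set A := morreyConst n α (inradius Ω) r p with hAdef
  have hV : 0 < volume.real Ω :=
    ENNReal.toReal_pos (ho.measure_pos _ hne).ne' hb.measure_lt_top.ne
  refine le_iInf₂ fun φ hφ => ?_
  obtain ⟨x, hxΩ, hM0, hM⟩ := hφ.exists_abs_le
  have hden := lintegral_rpow_abs_le hp0 ho (fun y hy => hφ.eq_zero_of_notMem hy) hM
  rw [← ENNReal.ofReal_toReal hb.measure_lt_top.ne, ← ENNReal.ofReal_mul (by positivity)] at hden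
  change _ ≤ ENNReal.ofReal (|φ x| ^ p * volume.real Ω) at hden
  have hnum : ENNReal.ofReal (|φ x| ^ p * (A⁻¹) ^ p) ≤ gagliardoEnergy α p φ := by
    by_cases hJ : gagliardoEnergy α p φ = ⊤
    · simp [hJ]
    obtain ⟨y, hy, hxy⟩ := exists_notMem_dist_le_inradius hn ho hb hxΩ
    have h1 := abs_sub_le_mul_toReal hφ.smooth.continuous hα hp hpn hJ hr hxy
    rw [hφ.eq_zero_of_notMem hy, sub_zero, ← morreyConst, ← hAdef] at h1
    have h2 : |φ x| * A⁻¹ ≤ (gagliardoEnergy α p φ ^ (1 / p)).toReal := by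
      rw [← div_eq_mul_inv, div_le_iff₀ hA]; linarith
    rw [← Real.mul_rpow (abs_nonneg _) (by positivity), ← ENNReal.ofReal_toReal hJ]
    refine ENNReal.ofReal_le_ofReal ?_
    rw [← ENNReal.toReal_rpow] at h2
    calc _ ≤ ((gagliardoEnergy α p φ).toReal ^ (1 / p)) ^ p := by gcongr
      _ = _ := by rw [one_div, Real.rpow_inv_rpow ENNReal.toReal_nonneg hp0.ne']
  rw [rayleighQuotient_eq_gagliardoEnergy_div]
  refine le_trans (le_of_eq ?_) (ENNReal.div_le_div hnum hden)
  rw [← ENNReal.ofReal_div_of_pos (by positivity)]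
  congr 1
  field_simp

lemma tendsto_const_rpow_inv_atTop {c : ℝ} (hc : 0 < c) :
    Tendsto (fun p : ℝ => c ^ (1 / p)) atTop (𝓝 1) := by
  have h : Tendsto (fun p : ℝ => 1 / p) atTop (𝓝 0) := by
    simpa using tendsto_inv_atTop_zero (𝕜 := ℝ)
  have := (Real.continuous_const_rpow hc.ne').tendsto 0 |>.comp h
  simpa [Function.comp_def] using this

lemma tendsto_morreyConst {R r : ℝ} (hr : 0 < r) :
    Tendsto (fun p => morreyConst n α R r p) atTop
      (𝓝 ((R + 2 * r) ^ α + 2 * ((2 * r) ^ α / (1 - 2 ^ (-(α / 2)))))) := by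
  have hc := unitBallVolume_pos n
  have h : ∀ c : ℝ, 0 < c → Tendsto (fun p : ℝ => c ^ (-(1 / p))) atTop (𝓝 1) := fun c hc => by
    simpa [Real.rpow_neg hc.le] using (tendsto_const_rpow_inv_atTop hc).inv₀ one_ne_zero
  have h1 := h _ (show 0 < r ^ n * unitBallVolume n * (r ^ n * unitBallVolume n) by positivity)
  have h2 := h _ (show 0 < r ^ n * unitBallVolume n * ((r / 2) ^ n * unitBallVolume n) by
    positivity)
  simpa [morreyConst] using (h1.const_mul ((R + 2 * r) ^ α)).add
    (((h2.const_mul ((2 * r) ^ α)).div_const (1 - 2 ^ (-(α / 2)))).const_mul 2)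

/-- The order of limits matters: `r` is fixed first, small enough that the limiting Morrey constant
still beats `a`, and only then does `p` grow. -/
lemma eventually_lt_firstEigenvalue_rpow (hn : 1 ≤ n) (ho : IsOpen Ω)
    (hb : Bornology.IsBounded Ω) (hne : Ω.Nonempty) (hα : 0 < α) {a : ℝ≥0∞}
    (ha : a < ENNReal.ofReal (1 / inradius Ω ^ α)) :
    ∀ᶠ p : ℝ in atTop, a < firstEigenvalue α p Ω ^ (1 / p) := by
  have hR := (exists_isGreatest_infDist_compl hn ho hne hb).1
  have hθ := one_sub_two_rpow_pos hα
  have hV : 0 < volume.real Ω :=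
    ENNReal.toReal_pos (ho.measure_pos _ hne).ne' hb.measure_lt_top.ne
  set R := inradius Ω
  have hlim : Tendsto (fun r : ℝ => ENNReal.ofReal
      ((R + 2 * r) ^ α + 2 * ((2 * r) ^ α / (1 - 2 ^ (-(α / 2)))))⁻¹) (𝓝[>] 0)
      (𝓝 (ENNReal.ofReal (1 / R ^ α))) := by
    refine (ENNReal.tendsto_ofReal ?_).mono_left nhdsWithin_le_nhds
    have hc : Continuous fun r : ℝ => (R + 2 * r) ^ α + 2 * ((2 * r) ^ α /
        (1 - 2 ^ (-(α / 2)))) := by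
      have h1 : Continuous fun r : ℝ => (R + 2 * r) ^ α :=
        (by fun_prop : Continuous fun r : ℝ => R + 2 * r).rpow_const fun _ => Or.inr hα.le
      have h2 : Continuous fun r : ℝ => (2 * r) ^ α :=
        (by fun_prop : Continuous fun r : ℝ => 2 * r).rpow_const fun _ => Or.inr hα.le
      exact h1.add (continuous_const.mul (h2.div_const _))
    have h0 : (R + 2 * 0) ^ α + 2 * ((2 * 0) ^ α / (1 - 2 ^ (-(α / 2)))) = R ^ α := by
      simp [Real.zero_rpow hα.ne']
    have := (hc.tendsto 0).inv₀ (by rw [h0]; positivity)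
    rwa [h0, ← one_div] at this
  obtain ⟨r, har, hr⟩ := ((hlim.eventually (lt_mem_nhds ha)).and self_mem_nhdsWithin).exists
  replace hr : 0 < r := hr
  have hlim2 : Tendsto (fun p : ℝ => ENNReal.ofReal
      ((volume.real Ω)⁻¹ ^ (1 / p) * (morreyConst n α R r p)⁻¹)) atTop
      (𝓝 (ENNReal.ofReal ((R + 2 * r) ^ α + 2 * ((2 * r) ^ α / (1 - 2 ^ (-(α / 2)))))⁻¹)) := by
    refine ENNReal.tendsto_ofReal ?_
    simpa using (tendsto_const_rpow_inv_atTop (inv_pos.2 hV)).mul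
      ((tendsto_morreyConst (n := n) (R := R) hr).inv₀ (by positivity))
  filter_upwards [hlim2.eventually (lt_mem_nhds har), eventually_ge_atTop (1 : ℝ),
    eventually_ge_atTop (4 * n / α)] with p h1 hp hpn
  have hp0 : 0 < p := by linarith
  rw [div_le_iff₀' hα] at hpn
  have hA := morreyConst_pos (n := n) (p := p) hα hR hr
  refine h1.trans_le ?_
  refine le_trans (le_of_eq ?_) (ENNReal.rpow_le_rpow
    (ofReal_le_firstEigenvalue hn ho hb hne hα hp hpn hr) (by positivity : 0 ≤ 1 / p))
  rw [ENNReal.ofReal_rpow_of_nonneg (by positivity) (by positivity),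
    Real.mul_rpow (by positivity) (by positivity), one_div,
    Real.rpow_rpow_inv (by positivity) hp0.ne']

/-- The set where a continuous function exceeds its essential supremum is open and null, hence
empty. -/
lemma enorm_apply_le_eLpNorm_top (hφ : Continuous φ) (x : EuclideanSpace ℝ (Fin n)) :
    ‖φ x‖ₑ ≤ eLpNorm φ ∞ volume := by
  have ho : IsOpen {x | eLpNorm φ ∞ volume < ‖φ x‖ₑ} :=
    isOpen_lt continuous_const (by fun_prop)
  have h0 : volume {x | eLpNorm φ ∞ volume < ‖φ x‖ₑ} = 0 := meas_eLpNormEssSup_lt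
  rw [ho.measure_eq_zero_iff volume] at h0
  by_contra! h
  exact (h0 ▸ h : x ∈ (∅ : Set _))

/-- The Hölder difference quotient, as a function on the product space. -/
noncomputable def holderQuotient (α : ℝ) (φ : EuclideanSpace ℝ (Fin n) → ℝ)
    (z : EuclideanSpace ℝ (Fin n) × EuclideanSpace ℝ (Fin n)) : ℝ :=
  (φ z.2 - φ z.1) / ‖z.2 - z.1‖ ^ α

lemma abs_sub_le_of_eLpNorm_holderQuotient_le (hφ : Continuous φ) {S : ℝ} (hα : 0 < α)
    (hS0 : 0 ≤ S)
    (hS : eLpNorm (holderQuotient α φ) ∞ (volume.prod volume) ≤ ENNReal.ofReal S)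
    (x y : EuclideanSpace ℝ (Fin n)) : |φ y - φ x| ≤ S * ‖y - x‖ ^ α := by
  -- Clearing the denominator makes both sides continuous across the diagonal, where the quotient
  -- itself need not be; the diagonal lies outside this set.
  have ho : IsOpen {z : EuclideanSpace ℝ (Fin n) × EuclideanSpace ℝ (Fin n) |
      S * ‖z.2 - z.1‖ ^ α < |φ z.2 - φ z.1|} := by
    refine isOpen_lt (continuous_const.mul ?_) (by fun_prop)
    exact (by fun_prop : Continuous fun z : EuclideanSpace ℝ (Fin n) ×
      EuclideanSpace ℝ (Fin n) => ‖z.2 - z.1‖).rpow_const fun _ => Or.inr hα.le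
  have h0 : (volume.prod volume) {z : EuclideanSpace ℝ (Fin n) × EuclideanSpace ℝ (Fin n) |
      S * ‖z.2 - z.1‖ ^ α < |φ z.2 - φ z.1|} = 0 := by
    refine measure_mono_null (fun z hz => ?_)
      (meas_eLpNormEssSup_lt (f := holderQuotient α φ) (μ := volume.prod volume))
    rw [mem_ofPred_eq] at hz ⊢
    refine (hS : eLpNormEssSup _ _ ≤ _).trans_lt ?_
    have hne : z.2 - z.1 ≠ 0 := fun h => by
      rw [sub_eq_zero.1 h] at hz
      simp [Real.zero_rpow hα.ne'] at hz
    have hpos := norm_pos_iff.2 hne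
    rw [Real.enorm_eq_ofReal_abs]
    refine (ENNReal.ofReal_lt_ofReal_iff_of_nonneg hS0).2 ?_
    rw [holderQuotient, abs_div, abs_of_nonneg (a := ‖z.2 - z.1‖ ^ α) (by positivity),
      lt_div_iff₀ (by positivity)]
    exact hz
  rw [ho.measure_eq_zero_iff (volume.prod volume)] at h0
  by_contra! h
  exact (h0 ▸ h : (x, y) ∈ (∅ : Set _))

lemma inftyQuotient_eq_div : inftyQuotient α φ =
    eLpNorm (holderQuotient α φ) ∞ (volume.prod volume) / eLpNorm φ ∞ volume := rfl

lemma ofReal_le_inftyEigenvalue (hn : 1 ≤ n) (ho : IsOpen Ω) (hb : Bornology.IsBounded Ω)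
    (hα : 0 < α) : ENNReal.ofReal (inradius Ω ^ (-α)) ≤ inftyEigenvalue α Ω := by
  refine le_iInf₂ fun φ hφ => ?_
  obtain ⟨x, hxΩ, hM0, hM⟩ := hφ.exists_abs_le
  have hR := (exists_isGreatest_infDist_compl hn ho ⟨x, hxΩ⟩ hb).1
  obtain ⟨y, hy, hxy⟩ := exists_notMem_dist_le_inradius hn ho hb hxΩ
  rw [inftyQuotient_eq_div]
  have hden : eLpNorm φ ∞ volume ≤ ENNReal.ofReal |φ x| := by
    refine eLpNormEssSup_le_of_ae_bound (Eventually.of_forall fun z => ?_)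
    exact hM z
  have hnum : ENNReal.ofReal (inradius Ω ^ (-α) * |φ x|) ≤
      eLpNorm (holderQuotient α φ) ∞ (volume.prod volume) := by
    by_cases hS : eLpNorm (holderQuotient α φ) ∞ (volume.prod volume) = ⊤
    · simp [hS]
    have h1 := abs_sub_le_of_eLpNorm_holderQuotient_le hφ.smooth.continuous hα
      ENNReal.toReal_nonneg (ENNReal.ofReal_toReal hS).ge y x
    rw [hφ.eq_zero_of_notMem hy, sub_zero, ← dist_eq_norm] at h1
    rw [← ENNReal.ofReal_toReal hS]
    refine ENNReal.ofReal_le_ofReal ?_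
    rw [Real.rpow_neg hR.le, inv_mul_le_iff₀ (by positivity), mul_comm]
    refine h1.trans ?_
    gcongr
  refine le_trans (le_of_eq ?_) (ENNReal.div_le_div hnum hden)
  rw [← ENNReal.ofReal_div_of_pos hM0, mul_div_cancel_right₀ _ hM0.ne']

end LowerBound

/-! ### Upper bounds -/

section UpperBound

variable {n : ℕ} {Ω : Set (EuclideanSpace ℝ (Fin n))} {φ : EuclideanSpace ℝ (Fin n) → ℝ}
  {α p K M : ℝ}

/-- The increment is split into powers `1 - α` and `α`, bounded by the oscillation and by the slope
respectively; this is where `α ≤ 1` is needed. -/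
lemma abs_sub_le_rpow_mul_rpow (hα : 0 < α) (hα1 : α ≤ 1)
    (hlip : ∀ x y, |φ y - φ x| ≤ ‖y - x‖) (hM : ∀ x y, |φ y - φ x| ≤ M)
    (x y : EuclideanSpace ℝ (Fin n)) : |φ y - φ x| ≤ M ^ (1 - α) * ‖y - x‖ ^ α := by
  calc |φ y - φ x| = |φ y - φ x| ^ (1 - α) * |φ y - φ x| ^ α := by
        rw [← Real.rpow_add_of_nonneg (abs_nonneg _) (by linarith) hα.le]; simp
    _ ≤ _ := by
        have h1 := hM x y
        have h2 := hlip x y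
        have h3 : 0 ≤ 1 - α := by linarith
        have h4 := (abs_nonneg _).trans h1
        gcongr

/-- The Hölder bound controls small distances and the oscillation bound large ones; together they
give a majorant without singularity that decays at infinity. -/
lemma abs_sub_rpow_div_le (hα : 0 < α) (hp : 0 < p) (hK : 0 ≤ K)
    (hhol : ∀ x y, |φ y - φ x| ≤ K * ‖y - x‖ ^ α) (hM : ∀ x y, |φ y - φ x| ≤ M)
    (x y : EuclideanSpace ℝ (Fin n)) :
    |φ y - φ x| ^ p / ‖y - x‖ ^ (α * p) ≤
      (2 ^ α * (K + M)) ^ p * (1 + ‖y - x‖) ^ (-(α * p)) := by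
  have hM0 : 0 ≤ M := (abs_nonneg _).trans (hM x y)
  rcases eq_or_ne y x with rfl | hne
  · simp only [sub_self, abs_zero, Real.zero_rpow hp.ne', zero_div]
    positivity
  set s := ‖y - x‖
  have hs : 0 < s := norm_pos_iff.2 (sub_ne_zero.2 hne)
  have key : |φ y - φ x| * (1 + s) ^ α ≤ 2 ^ α * (K + M) * s ^ α := by
    rcases le_total s 1 with h | h
    · calc _ ≤ K * s ^ α * 2 ^ α := by
            gcongr
            · exact hhol x y
            · linarith
        _ ≤ _ := by nlinarith [show 0 ≤ M * (2 ^ α * s ^ α) by positivity]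
    · calc _ ≤ M * (2 * s) ^ α := by
            gcongr
            · exact hM x y
            · linarith
        _ ≤ _ := by
            rw [Real.mul_rpow two_pos.le hs.le]
            nlinarith [show 0 ≤ K * (2 ^ α * s ^ α) by positivity]
  have h2 : (|φ y - φ x| * (1 + s) ^ α) ^ p ≤ (2 ^ α * (K + M) * s ^ α) ^ p := by gcongr
  rw [Real.mul_rpow (by positivity) (by positivity), Real.mul_rpow (by positivity) (by positivity),
    ← Real.rpow_mul (by positivity), ← Real.rpow_mul hs.le] at h2
  rw [Real.rpow_neg (by positivity), ← div_eq_mul_inv,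
    div_le_div_iff₀ (by positivity) (by positivity)]
  exact h2

/-- The integrand vanishes unless one of the two points lies in the support. By translation
invariance each case contributes the volume of the support times the integral of the majorant,
finite because `n < α * p`. -/
lemma gagliardoEnergy_lt_top (hα : 0 < α) (hp : n < α * p) (hK : 0 ≤ K)
    (hhol : ∀ x y, |φ y - φ x| ≤ K * ‖y - x‖ ^ α) (hM : ∀ x y, |φ y - φ x| ≤ M)
    (hsupp : HasCompactSupport φ) : gagliardoEnergy α p φ < ⊤ := by
  have hp0 : 0 < p := pos_of_mul_pos_right ((Nat.cast_nonneg n).trans_lt hp) hα.le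
  set S := tsupport φ
  have hSm : MeasurableSet S := (isClosed_tsupport φ).measurableSet
  have hS : volume S < ⊤ := hsupp.isCompact.measure_lt_top
  set C := ENNReal.ofReal ((2 ^ α * (K + M)) ^ p)
  let w : EuclideanSpace ℝ (Fin n) → ℝ≥0∞ := fun z => ENNReal.ofReal ((1 + ‖z‖) ^ (-(α * p)))
  have hwm : Measurable w := by fun_prop
  have hw : ∫⁻ z, w z < ⊤ := finite_integral_one_add_norm (by simpa using hp)
  have hle : ∀ y x, ENNReal.ofReal (|φ y - φ x| ^ p / ‖y - x‖ ^ (α * p)) ≤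
      C * (S.indicator 1 y * w (y - x) + S.indicator 1 x * w (y - x)) := fun y x => by
    by_cases h : y ∈ S ∨ x ∈ S
    · have h1 : (1 : ℝ≥0∞) ≤ S.indicator 1 y + S.indicator 1 x := by
        rcases h with h | h <;> simp [h]
      calc _ ≤ C * (1 * w (y - x)) := by
            rw [one_mul, ← ENNReal.ofReal_mul' (by positivity)]
            exact ENNReal.ofReal_le_ofReal (abs_sub_rpow_div_le hα hp0 hK hhol hM x y)
        _ ≤ _ := by rw [← add_mul]; gcongr
    · push Not at h
      simp [image_eq_zero_of_notMem_tsupport h.1, image_eq_zero_of_notMem_tsupport h.2, hp0.ne']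
  have hm1 : Measurable fun z : EuclideanSpace ℝ (Fin n) × EuclideanSpace ℝ (Fin n) =>
      S.indicator (1 : EuclideanSpace ℝ (Fin n) → ℝ≥0∞) z.1 * w (z.1 - z.2) :=
    ((measurable_one.indicator hSm).comp measurable_fst).mul (by fun_prop)
  have hm2 : Measurable fun z : EuclideanSpace ℝ (Fin n) × EuclideanSpace ℝ (Fin n) =>
      S.indicator (1 : EuclideanSpace ℝ (Fin n) → ℝ≥0∞) z.2 * w (z.1 - z.2) :=
    ((measurable_one.indicator hSm).comp measurable_snd).mul (by fun_prop)
  have h1 : ∫⁻ y, ∫⁻ x, S.indicator (1 : EuclideanSpace ℝ (Fin n) → ℝ≥0∞) y * w (y - x) =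
      volume S * ∫⁻ z, w z := by
    have : ∀ y, ∫⁻ x, S.indicator (1 : EuclideanSpace ℝ (Fin n) → ℝ≥0∞) y * w (y - x) =
        S.indicator 1 y * ∫⁻ z, w z := fun y => by
      rw [lintegral_const_mul _ (by fun_prop), lintegral_sub_left_eq_self w y]
    simp_rw [this]
    rw [lintegral_mul_const _ (measurable_one.indicator hSm), lintegral_indicator_one hSm]
  have h2 : ∫⁻ y, ∫⁻ x, S.indicator (1 : EuclideanSpace ℝ (Fin n) → ℝ≥0∞) x * w (y - x) =
      volume S * ∫⁻ z, w z := by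
    rw [lintegral_lintegral_swap hm2.aemeasurable]
    have : ∀ x, ∫⁻ y, S.indicator (1 : EuclideanSpace ℝ (Fin n) → ℝ≥0∞) x * w (y - x) =
        S.indicator 1 x * ∫⁻ z, w z := fun x => by
      rw [lintegral_const_mul _ (by fun_prop), lintegral_sub_right_eq_self w x]
    simp_rw [this]
    rw [lintegral_mul_const _ (measurable_one.indicator hSm), lintegral_indicator_one hSm]
  calc gagliardoEnergy α p φ
      ≤ ∫⁻ y, ∫⁻ x, C * (S.indicator 1 y * w (y - x) + S.indicator 1 x * w (y - x)) :=
        lintegral_mono fun y => lintegral_mono fun x => hle y x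
    _ = C * (volume S * (∫⁻ z, w z) + volume S * ∫⁻ z, w z) := by
        have h3 : ∀ y, ∫⁻ x, C * (S.indicator 1 y * w (y - x) + S.indicator 1 x * w (y - x)) =
            C * ((∫⁻ x, S.indicator 1 y * w (y - x)) + ∫⁻ x, S.indicator 1 x * w (y - x)) :=
          fun y => by
            rw [lintegral_const_mul' _ _ ENNReal.ofReal_ne_top]
            exact congrArg (C * ·) (lintegral_add_left (hm1.comp measurable_prodMk_left) _)
        simp_rw [h3]
        rw [lintegral_const_mul' _ _ ENNReal.ofReal_ne_top,
          lintegral_add_left hm1.lintegral_prod_right', h1, h2]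
    _ < ⊤ := by
        refine ENNReal.mul_lt_top ENNReal.ofReal_lt_top (ENNReal.add_lt_top.2 ⟨?_, ?_⟩) <;>
        exact ENNReal.mul_lt_top hS hw

lemma gagliardoEnergy_le_mul {q : ℝ} (hq : 0 < q) (hqp : q ≤ p) (hK : 0 < K)
    (hhol : ∀ x y, |φ y - φ x| ≤ K * ‖y - x‖ ^ α) :
    gagliardoEnergy α p φ ≤ ENNReal.ofReal (K ^ (p - q)) * gagliardoEnergy α q φ := by
  rw [gagliardoEnergy, gagliardoEnergy, ← lintegral_const_mul' _ _ ENNReal.ofReal_ne_top]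
  refine lintegral_mono fun y => ?_
  rw [← lintegral_const_mul' _ _ ENNReal.ofReal_ne_top]
  refine lintegral_mono fun x => ?_
  rw [← ENNReal.ofReal_mul (by positivity)]
  refine ENNReal.ofReal_le_ofReal ?_
  rcases eq_or_ne y x with rfl | hne
  · simp [hq.ne', (hq.trans_le hqp).ne']
  have hs : 0 < ‖y - x‖ := norm_pos_iff.2 (sub_ne_zero.2 hne)
  have h0 : 0 ≤ |φ y - φ x| / ‖y - x‖ ^ α := by positivity
  have h1 : |φ y - φ x| / ‖y - x‖ ^ α ≤ K := (div_le_iff₀ (by positivity)).2 (hhol x y)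
  rw [Real.rpow_mul hs.le, Real.rpow_mul hs.le, ← Real.div_rpow (by positivity) (by positivity),
    ← Real.div_rpow (by positivity) (by positivity)]
  calc _ = (|φ y - φ x| / ‖y - x‖ ^ α) ^ (p - q) * (|φ y - φ x| / ‖y - x‖ ^ α) ^ q := by
        rw [← Real.rpow_add_of_nonneg h0 (by linarith) hq.le, sub_add_cancel]
    _ ≤ _ := by
        have : 0 ≤ p - q := by linarith
        gcongr

lemma ofReal_mul_volume_le_lintegral (hp : 0 < p) (hφ : Continuous φ) {c : ℝ} (hc : 0 ≤ c) :
    ENNReal.ofReal (c ^ p) * volume {x | c < |φ x|} ≤ ∫⁻ x, ENNReal.ofReal (|φ x| ^ p) := by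
  rw [← lintegral_indicator_const (measurableSet_lt measurable_const hφ.abs.measurable)]
  refine lintegral_mono fun x => ?_
  by_cases hx : x ∈ {x | c < |φ x|}
  · rw [indicator_of_mem hx]
    rw [mem_ofPred_eq] at hx
    gcongr
  · rw [indicator_of_notMem hx]
    exact zero_le

/-- The fractional Rayleigh quotients of `φ` grow at most like the `p`-th powers of the
Hölder quotient, up to a constant factor. -/
lemma exists_rayleighQuotient_le (hα : 0 < α) (hφ : Continuous φ) (hsupp : HasCompactSupport φ)
    (hK : 0 < K) (hhol : ∀ x y, |φ y - φ x| ≤ K * ‖y - x‖ ^ α) {c : ℝ} (hc : 0 < c)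
    (hM : ∀ x y, |φ y - φ x| ≤ M) {x₀ : EuclideanSpace ℝ (Fin n)} (hx₀ : c < |φ x₀|) :
    ∃ D : ℝ, 0 < D ∧ ∀ᶠ p : ℝ in atTop,
      rayleighQuotient α p φ ≤ ENNReal.ofReal (D * (K / c) ^ p) := by
  -- This makes `α * q = n + 1 > n`, so the reference energy is finite.
  obtain ⟨q, hq⟩ : ∃ q, q = (n + 1) / α := ⟨_, rfl⟩
  have hq0 : 0 < q := by rw [hq]; positivity
  have hJ : gagliardoEnergy α q φ < ⊤ :=
    gagliardoEnergy_lt_top hα (by rw [hq, mul_div_cancel₀ _ hα.ne']; linarith) hK.le hhol hM hsupp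
  have hopen : IsOpen {x | c < |φ x|} := isOpen_lt continuous_const hφ.abs
  have hVpos : 0 < volume {x | c < |φ x|} := hopen.measure_pos _ ⟨x₀, hx₀⟩
  have hVtop : volume {x | c < |φ x|} < ⊤ := by
    refine (measure_mono fun x hx => ?_).trans_lt hsupp.isCompact.measure_lt_top
    exact subset_tsupport _ (abs_pos.1 (hc.trans hx))
  set V := volume {x | c < |φ x|}
  have hV0 : 0 < V.toReal := ENNReal.toReal_pos hVpos.ne' hVtop.ne
  -- The `+ 1` makes `D` positive without a lower bound on the energy.
  refine ⟨((gagliardoEnergy α q φ).toReal + 1) / (K ^ q * V.toReal), by positivity, ?_⟩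
  filter_upwards [eventually_ge_atTop q] with p hqp
  have hp0 : 0 < p := hq0.trans_le hqp
  have hnum : gagliardoEnergy α p φ ≤
      ENNReal.ofReal (K ^ (p - q) * ((gagliardoEnergy α q φ).toReal + 1)) := by
    refine (gagliardoEnergy_le_mul hq0 hqp hK hhol).trans ?_
    rw [ENNReal.ofReal_mul (by positivity)]
    gcongr
    exact (ENNReal.ofReal_toReal hJ.ne).ge.trans (ENNReal.ofReal_le_ofReal (by linarith))
  have hden := ofReal_mul_volume_le_lintegral hp0 hφ hc.le
  change _ * V ≤ _ at hden
  rw [← ENNReal.ofReal_toReal hVtop.ne, ← ENNReal.ofReal_mul (by positivity)] at hden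
  rw [rayleighQuotient_eq_gagliardoEnergy_div]
  refine (ENNReal.div_le_div hnum hden).trans_eq ?_
  rw [← ENNReal.ofReal_div_of_pos (by positivity), Real.rpow_sub hK, Real.div_rpow hK.le hc.le]
  congr 1
  field_simp

lemma eventually_firstEigenvalue_rpow_lt (hn : 1 ≤ n) (ho : IsOpen Ω)
    (hb : Bornology.IsBounded Ω) (hne : Ω.Nonempty) (hα : 0 < α) (hα1 : α ≤ 1) {b : ℝ≥0∞}
    (hlt : ENNReal.ofReal (1 / inradius Ω ^ α) < b) :
    ∀ᶠ p : ℝ in atTop, firstEigenvalue α p Ω ^ (1 / p) < b := by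
  obtain ⟨hR, ⟨x₀, -, hx₀⟩, -⟩ := exists_isGreatest_infDist_compl hn ho hne hb
  have hball := ball_infDist_compl_subset (Ω := Ω) x₀
  simp only at hx₀
  rw [hx₀] at hball
  set R := inradius Ω
  -- The parameter `t` absorbs two losses: the cone has height at least `t * R`, and the denominator
  -- is estimated on the set where `|φ|` exceeds `t` times that height.
  have hlim : Tendsto (fun t : ℝ => ENNReal.ofReal (1 / (t * (t * R) ^ α))) (𝓝[<] 1)
      (𝓝 (ENNReal.ofReal (1 / R ^ α))) := by
    refine (ENNReal.tendsto_ofReal ?_).mono_left nhdsWithin_le_nhds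
    have hc : Continuous fun t : ℝ => t * (t * R) ^ α :=
      continuous_id.mul ((by fun_prop : Continuous fun t : ℝ => t * R).rpow_const
        fun _ => Or.inr hα.le)
    have := (hc.tendsto 1).inv₀ (by simp only [one_mul]; positivity)
    simpa using this
  obtain ⟨t, htb, ht1, ht0⟩ := ((hlim.eventually (gt_mem_nhds hlt)).and
    (eventually_mem_nhdsWithin.and (mem_nhdsWithin_of_mem_nhds (lt_mem_nhds zero_lt_one)))).exists
  replace ht1 : t < 1 := ht1
  replace ht0 : 0 < t := ht0
  obtain ⟨φ, hφ, hlip, h0, hmax, hm⟩ := exists_isAdmissible_lipschitz (m := t * R) (R := R)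
    (by positivity) (by nlinarith) hball
  have hM0 : 0 < φ x₀ := lt_of_lt_of_le (by positivity) hm
  have hM : ∀ x y, |φ y - φ x| ≤ φ x₀ := fun x y =>
    abs_le.2 ⟨by linarith [h0 y, hmax x], by linarith [h0 x, hmax y]⟩
  obtain ⟨D, hD, hev⟩ := exists_rayleighQuotient_le (c := t * φ x₀) hα hφ.smooth.continuous
    hφ.compactSupport (by positivity) (abs_sub_le_rpow_mul_rpow hα hα1 hlip hM) (by positivity) hM
    (x₀ := x₀) (by rw [abs_of_pos hM0]; nlinarith)
  have hKc : φ x₀ ^ (1 - α) / (t * φ x₀) ≤ 1 / (t * (t * R) ^ α) := by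
    rw [Real.rpow_sub hM0, Real.rpow_one, div_div, div_le_div_iff₀ (by positivity) (by positivity)]
    calc φ x₀ * (t * (t * R) ^ α) ≤ φ x₀ * (t * φ x₀ ^ α) := by gcongr
      _ = _ := by ring
  have hlim2 : Tendsto (fun p : ℝ => ENNReal.ofReal (D ^ (1 / p) * (1 / (t * (t * R) ^ α)))) atTop
      (𝓝 (ENNReal.ofReal (1 / (t * (t * R) ^ α)))) := by
    refine ENNReal.tendsto_ofReal ?_
    simpa using (tendsto_const_rpow_inv_atTop hD).mul_const (1 / (t * (t * R) ^ α))
  filter_upwards [hlim2.eventually (gt_mem_nhds htb), hev, eventually_gt_atTop 0] with p h1 h2 hp0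
  refine lt_of_le_of_lt ?_ h1
  calc firstEigenvalue α p Ω ^ (1 / p)
      ≤ ENNReal.ofReal (D * (φ x₀ ^ (1 - α) / (t * φ x₀)) ^ p) ^ (1 / p) := by
        gcongr
        exact (iInf₂_le φ hφ).trans h2
    _ = ENNReal.ofReal (D ^ (1 / p) * (φ x₀ ^ (1 - α) / (t * φ x₀))) := by
        rw [ENNReal.ofReal_rpow_of_nonneg (by positivity) (by positivity),
          Real.mul_rpow hD.le (by positivity), one_div, Real.rpow_rpow_inv (by positivity) hp0.ne']
    _ ≤ _ := by gcongr

lemma inftyEigenvalue_le_ofReal (hn : 1 ≤ n) (ho : IsOpen Ω) (hb : Bornology.IsBounded Ω)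
    (hne : Ω.Nonempty) (hα : 0 < α) (hα1 : α ≤ 1) :
    inftyEigenvalue α Ω ≤ ENNReal.ofReal (inradius Ω ^ (-α)) := by
  obtain ⟨hR, ⟨x₀, -, hx₀⟩, -⟩ := exists_isGreatest_infDist_compl hn ho hne hb
  have hball := ball_infDist_compl_subset (Ω := Ω) x₀
  simp only at hx₀
  rw [hx₀] at hball
  set R := inradius Ω
  have hle : ∀ m, 0 < m → m < R → inftyEigenvalue α Ω ≤ ENNReal.ofReal (m ^ (-α)) := by
    intro m hm0 hmR
    obtain ⟨φ, hφ, hlip, h0, hmax, hm⟩ := exists_isAdmissible_lipschitz hm0 hmR hball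
    have hM0 : 0 < φ x₀ := hm0.trans_le hm
    have hM : ∀ x y, |φ y - φ x| ≤ φ x₀ := fun x y =>
      abs_le.2 ⟨by linarith [h0 y, hmax x], by linarith [h0 x, hmax y]⟩
    have hnum : eLpNorm (holderQuotient α φ) ∞ (volume.prod volume) ≤
        ENNReal.ofReal (φ x₀ ^ (1 - α)) := by
      refine eLpNormEssSup_le_of_ae_bound (Eventually.of_forall fun z => ?_)
      rw [holderQuotient, norm_div, Real.norm_eq_abs, Real.norm_eq_abs,
        abs_of_nonneg (a := ‖z.2 - z.1‖ ^ α) (by positivity)]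
      exact div_le_of_le_mul₀ (by positivity) (by positivity)
        (abs_sub_le_rpow_mul_rpow hα hα1 hlip hM z.1 z.2)
    have hden : ENNReal.ofReal (φ x₀) ≤ eLpNorm φ ∞ volume := by
      rw [← abs_of_pos hM0, ← Real.enorm_eq_ofReal_abs]
      exact enorm_apply_le_eLpNorm_top hφ.smooth.continuous x₀
    refine (iInf₂_le φ hφ).trans ?_
    rw [inftyQuotient_eq_div]
    refine (ENNReal.div_le_div hnum hden).trans ?_
    rw [← ENNReal.ofReal_div_of_pos hM0]
    refine ENNReal.ofReal_le_ofReal ?_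
    rw [← Real.rpow_sub_one hM0.ne', show 1 - α - 1 = -α by ring]
    exact Real.rpow_le_rpow_of_nonpos hm0 hm (by linarith)
  -- Smooth cones only reach heights `m < R`, so the sharp constant comes from the limit `m → R`.
  have hlim : Tendsto (fun m : ℝ => ENNReal.ofReal (m ^ (-α))) (𝓝[<] R)
      (𝓝 (ENNReal.ofReal (R ^ (-α)))) :=
    (ENNReal.tendsto_ofReal (Real.continuousAt_rpow_const R _ (Or.inl hR.ne')).tendsto).mono_left
      nhdsWithin_le_nhds
  refine ge_of_tendsto hlim ?_
  filter_upwards [self_mem_nhdsWithin, mem_nhdsWithin_of_mem_nhds (lt_mem_nhds hR)] with m h1 h2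
  exact hle m h2 h1

end UpperBound

theorem mainTheorem1 {n : ℕ} (hn : 1 ≤ n) (Ω : Set (EuclideanSpace ℝ (Fin n)))
    (hΩ_open : IsOpen Ω) (hΩ_conn : IsConnected Ω) (hΩ_bdd : Bornology.IsBounded Ω)
    (α : ℝ) (hα_pos : 0 < α) (hα_le : α ≤ 1) :
    -- the supremum defining `R` is a positive maximum, the radius of the largest inscribed ball
    0 < inradius Ω ∧
    IsGreatest ((fun x => Metric.infDist x Ωᶜ) '' Ω) (inradius Ω) ∧
    IsGreatest {r : ℝ | ∃ x, Metric.ball x r ⊆ Ω} (inradius Ω) ∧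
    -- the limit of the `p`-th roots of the first eigenvalues
    Tendsto (fun p : ℝ => firstEigenvalue α p Ω ^ (1 / p)) atTop
      (𝓝 (ENNReal.ofReal (1 / inradius Ω ^ α))) ∧
    -- the `∞`-eigenvalue
    inftyEigenvalue α Ω = ENNReal.ofReal (inradius Ω ^ (-α)) := by
  have hne := hΩ_conn.nonempty
  obtain ⟨hR, hg⟩ := exists_isGreatest_infDist_compl hn hΩ_open hne hΩ_bdd
  exact ⟨hR, hg, isGreatest_radius_inscribed_ball hn hΩ_open hne hΩ_bdd,
    tendsto_order.2
      ⟨fun _ h => eventually_lt_firstEigenvalue_rpow hn hΩ_open hΩ_bdd hne hα_pos h,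
        fun _ h => eventually_firstEigenvalue_rpow_lt hn hΩ_open hΩ_bdd hne hα_pos hα_le h⟩,
    (inftyEigenvalue_le_ofReal hn hΩ_open hΩ_bdd hne hα_pos hα_le).antisymm
      (ofReal_le_inftyEigenvalue hn hΩ_open hΩ_bdd hα_pos)⟩
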